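/- Let $L$ be an even positive integer, $\beta = L^2$, and $1 \le m \le M$. Let $\mu$ be Haar probability measure on the unit circle $\mathbb T$, and consider the circular $\beta$-ensemble of $M$ particles, with joint density with respect to $\mu^M$ $$f(\mathbf x) = \frac{1}{M!\,Z}\prod_{1\le j<k\le M}|x_k-x_j|^{\beta},\qquad Z = \frac{1}{M!}\int_{\mathbb T^M}\prod_{j<k}|x_k-x_j|^{\beta}\,d\mu^M(\mathbf x).$$ Let $$R_m(\mathbf y) = \frac{M!}{(M-m)!}\int_{\mathbb T^{M-m}} f(y_1,\dots,y_m,x_1,\dots,x_{M-m})\,d\mu^{M-m}(\mathbf x),\qquad \mathbf y\in\mathbb T^m.$$ Put $N' = L(M-m)$ and let $\mathbf e_0,\dots,\mathbf e_{N'-1}$ be the standard basis of $V'=\mathbb C^{N'}$. For an $L$-element subset $\mathfrak u=\{\mathfrak u(1)<\dots<\mathfrak u(L)\}$ of $\{0,\dots,N'-1\}$ let $\mathbf e_{\mathfrak u}=\mathbf e_{\mathfrak u(1)}\wedge\dots\wedge\mathbf e_{\mathfrak u(L)}$, $$\widetilde\Delta\mathfrak u = \prod_{1\le j<k\le L}\frac{\mathfrak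 u(k)-\mathfrak u(j)}{k-j},\qquad \delta\mathfrak u = \sum_{k=1}^L\mathfrak u(k) - \frac{L(N'-1)}2,$$ and for $j\in\mathbb Z$ let $\epsilon^j = \sum_{\delta\mathfrak u=j}\widetilde\Delta\mathfrak u\;\mathbf e_{\mathfrak u}\in\Lambda^L V'$. For $\mathbf y\in\mathbb T^m$ let $b_j(\mathbf y)$, $|j|\le\beta m/2$, be the coefficients of the Laurent polynomial $$f_{\mathbf y}^{\beta}(x) = x^{-\beta m/2}\prod_{n=1}^m (x-y_n)^{\beta} = \sum_{j=-\beta m/2}^{\beta m/2} b_j(\mathbf y)\,x^j,\qquad\text{and put}\qquad f_{\mathbf y}^{\beta}(\epsilon) = \sum_{j=-\beta m/2}^{\beta m/2} b_j(\mathbf y)\,\epsilon^j .$$ For $\omega\in\Lambda^L V'$ let the hyperpfaffian $\mathrm{PF}\,\omega$ be the coefficient of $\mathbf e_0\wedge\dots\wedge\mathbf e_{N'-1}$ in $\omega^{\wedge(M-m)}/(M-m)!$. Then $R_m$ is an $m$th correlation function of the ensemble, that is, $R_m$ is non-negative and measurable, and for all pairwise disjoint Borel sets $B_1,\dots,B_m\subset\mathbb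 T$, with $N_B$ the number of particles in $B$, $$\mathbb E[N_{B_1}\cdots N_{B_m}] = \int_{B_1}\cdots\int_{B_m} R_m\,d\mu^m ;$$ and for every $\mathbf y\in\mathbb T^m$ $$R_m(\mathbf y) = M!\,\binom{\beta M/2}{\beta/2,\dots,\beta/2}^{-1}\prod_{1\le j<k\le m}|y_k-y_j|^{\beta}\cdot\prod_{n=1}^m y_n^{-\beta(M-m)/2}\cdot\mathrm{PF}\,f_{\mathbf y}^{\beta}(\epsilon).$$ -/

import Mathlib

noncomputable section

namespace CircularEnsemble

open MeasureTheory

/-! ### The circular ensemble and its correlation functions -/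

/-- The unit circle carries its Borel σ-algebra. -/
instance instMeasurableSpaceCircle : MeasurableSpace Circle := borel Circle

instance instBorelSpaceCircle : BorelSpace Circle := ⟨rfl⟩

/-- Haar probability measure on the unit circle. -/
def haarCircle : Measure Circle := Measure.haarMeasure ⊤

/-- The product `μ^M` of `M` copies of Haar probability measure. -/
def haarTorus (M : ℕ) : Measure (Fin M → Circle) := Measure.pi fun _ => haarCircle

/-- The product `∏_{j < k} |x_k - x_j|^β`. -/
def absVandermonde (β : ℕ) {M : ℕ} (x : Fin M → Circle) : ℝ :=
  ∏ j : Fin M, ∏ k ∈ Finset.Ioi j, ‖(x k : ℂ) - (x j : ℂ)‖ ^ β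

/-- The partition function `Z = (1 / M!) ∫ ∏_{j < k} |x_k - x_j|^β dμ^M`. -/
def partitionFunction (β M : ℕ) : ℝ :=
  (1 / (M.factorial : ℝ)) * ∫ x, absVandermonde β x ∂(haarTorus M)

/-- The joint density `f = (1 / (M! Z)) ∏_{j < k} |x_k - x_j|^β`. -/
def jointDensity (β : ℕ) {M : ℕ} (x : Fin M → Circle) : ℝ :=
  (1 / ((M.factorial : ℝ) * partitionFunction β M)) * absVandermonde β x

/-- The joint law of the `M` particles of the circular `β`-ensemble. -/
def law (β M : ℕ) : Measure (Fin M → Circle) :=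
  (haarTorus M).withDensity fun x => ENNReal.ofReal (jointDensity β x)

/-- The occupation number `N_B(x)`: how many coordinates of `x` lie in `B`. -/
def occupation {M : ℕ} (B : Set Circle) (x : Fin M → Circle) : ℕ :=
  {i : Fin M | x i ∈ B}.ncard

/-- `R` is an `m`-th correlation function of the point process with joint law `P`:
`E[N_{B_1} ⋯ N_{B_m}] = ∫_{B_1} ⋯ ∫_{B_m} R dμ^m` for all pairwise disjoint `B_1, …, B_m`. -/
structure IsCorrelationFunction {M : ℕ} (P : Measure (Fin M → Circle)) (m : ℕ)
    (R : (Fin m → Circle) → ℝ) : Prop where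
  nonneg : ∀ y, 0 ≤ R y
  measurable : Measurable R
  expectation_eq : ∀ B : Fin m → Set Circle, (∀ i, MeasurableSet (B i)) →
    Pairwise (fun i j => Disjoint (B i) (B j)) →
    ∫⁻ x, ∏ i, (occupation (B i) x : ENNReal) ∂P =
      ∫⁻ y in Set.univ.pi B, ENNReal.ofReal (R y) ∂(haarTorus m)

/-- The configuration `(y_1, …, y_m, x_1, …, x_{M - m})`. -/
def concat {m M : ℕ} (h : m ≤ M) (y : Fin m → Circle) (x : Fin (M - m) → Circle) :
    Fin M → Circle :=
  fun i => Fin.append y x (Fin.cast (Nat.add_sub_of_le h).symm i)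

/-- The `m`-th correlation function of the circular `β`-ensemble, at every point `y`:
`R_m(y) = M! / (M - m)! ∫ f(y_1, …, y_m, x_1, …, x_{M - m}) dμ^{M - m}(x)`. -/
def correlation (β : ℕ) {m M : ℕ} (h : m ≤ M) (y : Fin m → Circle) : ℝ :=
  ((M.factorial : ℝ) / ((M - m).factorial : ℝ)) *
    ∫ x, jointDensity β (concat h y x) ∂(haarTorus (M - m))

/-! ### Hyperpfaffians -/

/-- The exterior algebra of `V = ℂ^N` with basis `e_0, …, e_{N-1}`. -/
abbrev Ext (N : ℕ) : Type := ExteriorAlgebra ℂ (Fin N → ℂ)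

/-- The multivector `e_t = e_{t(0)} ∧ ⋯ ∧ e_{t(n-1)}`. -/
def basisVector {N n : ℕ} (t : Fin n → Fin N) : Ext N :=
  ExteriorAlgebra.ιMulti ℂ n fun k => Pi.single (t k) (1 : ℂ)

/-- The Hodge star on the top degree: the coefficient of `e_0 ∧ ⋯ ∧ e_{N-1}` in a multivector.
It is the linear functional given by the determinant in degree `N` and by `0` in the others. -/
def volumeCoeff (N : ℕ) : Ext N →ₗ[ℂ] ℂ :=
  ExteriorAlgebra.liftAlternating (Pi.single N Matrix.detRowAlternating)

/-- The hyperpfaffian `PF ω = * (ω^{∧ K} / K!)` of an `L`-vector over `ℂ^{L K}`. -/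
def hyperpfaffian (L K : ℕ) (ω : Ext (L * K)) : ℂ :=
  volumeCoeff (L * K) ((K.factorial : ℂ)⁻¹ • ω ^ K)

/-! ### The `L`-vectors of the circular ensemble -/

/-- `Δ̃ 𝔲 = ∏_{j < k} (𝔲(k) - 𝔲(j)) / (k - j)`. -/
def normVandermonde {N L : ℕ} (u : Fin L → Fin N) : ℂ :=
  ∏ j : Fin L, ∏ k ∈ Finset.Ioi j,
    (((u k : ℕ) : ℂ) - ((u j : ℕ) : ℂ)) / (((k : ℕ) : ℂ) - ((j : ℕ) : ℂ))

/-- `δ 𝔲 = Σ 𝔲 - L (N - 1) / 2`. -/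
def excess {N L : ℕ} (u : Fin L → Fin N) : ℚ :=
  (∑ k, ((u k : ℕ) : ℚ)) - (L : ℚ) * ((N : ℚ) - 1) / 2

open Classical in
/-- `ε^j = ∑_{δ 𝔲 = j} Δ̃ 𝔲 e_𝔲`. The sum is over the `L`-element subsets `𝔲` of
`{0, …, N - 1}`, written as strictly increasing maps. -/
def epsilon (N L : ℕ) (j : ℤ) : Ext N :=
  ∑ u : Fin L → Fin N with StrictMono u ∧ excess u = (j : ℚ),
    normVandermonde u • basisVector u

/-- The Laurent polynomial `f_y^β(x) = x^{-β m / 2} ∏_n (x - y_n)^β`, for even `β`. -/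
def fPow (β : ℕ) {m : ℕ} (y : Fin m → Circle) : LaurentPolynomial ℂ :=
  LaurentPolynomial.T (-((β / 2 * m : ℕ) : ℤ)) *
    ∏ n, (LaurentPolynomial.T 1 - LaurentPolynomial.C (y n : ℂ)) ^ β

/-- `f_y^β(ε) = ∑_{j = -β m / 2}^{β m / 2} b_j(y) ε^j`, where `b_j(y)` is the coefficient of `x^j`
in `f_y^β(x)`, for even `β`. -/
def fPowEpsilon (β N L : ℕ) {m : ℕ} (y : Fin m → Circle) : Ext N :=
  ∑ j ∈ Finset.Icc (-((β / 2 * m : ℕ) : ℤ)) ((β / 2 * m : ℕ) : ℤ),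
    (fPow β y).coeff j • epsilon N L j

end CircularEnsemble

end

noncomputable section

namespace CircularEnsemble

open MeasureTheory

/-! ### Integration against Haar measure on the circle -/

/-! Write `β = 2k` and `K = M - m`. The correlation property uses only the symmetry of the density:
a product of occupation numbers of disjoint sets is a sum over injections of `m` labels into `M`
particles, and all injections contribute equally.

For the formula, `|z - w|^2 = (1 - z/w)(1 - w/z)` on the circle turns the density into a Dyson
product, so Dyson's constant term identity (`integral_dysonProd`, by Good's recursion) gives `M! Z`
as a multinomial coefficient. In the integral for `R_m` the `y`-part factors out. The `x`-part is,
up to powers of the `x_i`, a product of `L^2`-th powers of differences of the `x_i⁻¹`, that is, a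
confluent Vandermonde determinant (`det_confluentVandermonde`). This determinant is the volume
coefficient of a product of `K` multivectors, each depending on a single `x_i`
(`volumeCoeff_prod_confluentWedge`). By multilinearity and Fubini each factor is integrated
separately (`integral_multilinearMap_sum_smul`). The coefficient of `e_𝔲` carries `z^(-δ𝔲)
f_y^β(z)`, whose integral is `b_{δ𝔲}`, so each factor becomes `f_y^β(ε)`. -/

instance : Measure.IsHaarMeasure haarCircle := by unfold haarCircle; infer_instance

instance : IsProbabilityMeasure haarCircle :=
  ⟨by rw [haarCircle, ← TopologicalSpace.PositiveCompacts.coe_top]; exact Measure.haarMeasure_self⟩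

instance (M : ℕ) : IsProbabilityMeasure (haarTorus M) := by unfold haarTorus; infer_instance

theorem integrable_of_continuous {X E : Type*} [TopologicalSpace X] [CompactSpace X]
    [MeasurableSpace X] [OpensMeasurableSpace X] [NormedAddCommGroup E] [SecondCountableTopology E]
    [MeasurableSpace E] [BorelSpace E]
    {μ : Measure X} [IsFiniteMeasure μ] {f : X → E} (hf : Continuous f) : Integrable f μ := by
  obtain ⟨C, hC⟩ := isCompact_univ.exists_bound_of_continuousOn (f := f) hf.continuousOn
  exact Integrable.of_bound hf.measurable.aestronglyMeasurable C (ae_of_all _ fun x => hC x trivial)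

theorem integral_zpow_haarCircle (n : ℤ) :
    ∫ z : Circle, (z : ℂ) ^ n ∂haarCircle = if n = 0 then 1 else 0 := by
  split_ifs with hn
  · simp [hn]
  -- Since `w ^ n = -1`, rotation by `w` negates the integrand while preserving the measure.
  · set w : Circle := Circle.exp (Real.pi / n)
    have hw : (w : ℂ) ^ n = -1 := by
      rw [← Circle.coe_zpow, ← Circle.exp_zsmul, zsmul_eq_mul,
        mul_div_cancel₀ _ (by exact_mod_cast hn), Circle.coe_exp, Complex.exp_pi_mul_I]
    have h := integral_mul_left_eq_self (μ := haarCircle) (fun z : Circle => (z : ℂ) ^ n) w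
    simp only [Circle.coe_mul, mul_zpow, hw, neg_one_mul, integral_neg] at h
    linear_combination (-1 / 2 : ℂ) * h

theorem integral_eval_inv_haarCircle (p : Polynomial ℂ) :
    ∫ z : Circle, p.eval (z : ℂ)⁻¹ ∂haarCircle = p.eval 0 := by
  simp_rw [Polynomial.eval_eq_sum_range]
  rw [integral_finsetSum]
  · refine Finset.sum_congr rfl fun i _ => ?_
    have := integral_zpow_haarCircle (-i)
    simp only [zpow_neg, zpow_natCast] at this
    simp only [inv_pow, integral_const_mul, this]
    rcases eq_or_ne i 0 with rfl | h <;> simp_all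
  · intro i _
    exact integrable_of_continuous (by simp_rw [← Circle.coe_inv]; fun_prop)

/-! ### Dyson's constant term identity -/

/-- The product `∏_{i ≠ j} (1 - x_i / x_j)^{a_i}`. -/
def dysonProd {ι K : Type*} [Fintype ι] [DecidableEq ι] [Field K] (a : ι → ℕ) (x : ι → K) : K :=
  ∏ i, ∏ j, if i = j then 1 else (1 - x i / x j) ^ a i

section

variable {ι K : Type*} [Fintype ι] [DecidableEq ι] [Field K]

theorem dysonProd_eq_zero {a : ι → ℕ} {x : ι → K} {i j : ι} (hij : i ≠ j) (hx : x i = x j)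
    (h0 : x j ≠ 0) (ha : a i ≠ 0) : dysonProd a x = 0 := by
  refine Finset.prod_eq_zero (Finset.mem_univ i) (Finset.prod_eq_zero (Finset.mem_univ j) ?_)
  simp [hij, hx, h0, ha]

/-- The factor split off is the reciprocal of the `k`-th Lagrange basis polynomial at `0` when the
nodes are distinct and nonzero. -/
theorem dysonProd_mul_of_pos {a : ι → ℕ} (x : ι → K) {k : ι} (hk : 0 < a k) :
    dysonProd a x = dysonProd (Function.update a k (a k - 1)) x *
      ∏ j ∈ Finset.univ.erase k, (1 - x k / x j) := by
  have h : ∏ j ∈ Finset.univ.erase k, (1 - x k / x j) =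
      ∏ i, ∏ j, if i = j then 1 else if i = k then 1 - x i / x j else 1 := by
    rw [Finset.prod_eq_single (f := fun i => ∏ j, if i = j then (1 : K) else
      if i = k then 1 - x i / x j else 1) k]
    · rw [← Finset.mul_prod_erase Finset.univ _ (Finset.mem_univ k)]
      simp only [if_true, one_mul]
      refine Finset.prod_congr rfl fun j hj => ?_
      rw [if_neg (Finset.ne_of_mem_erase hj).symm]
    · intro b _ hb
      simp [hb]
    · simp
  rw [h, dysonProd, dysonProd, ← Finset.prod_mul_distrib]
  refine Finset.prod_congr rfl fun i _ => ?_
  rw [← Finset.prod_mul_distrib]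
  refine Finset.prod_congr rfl fun j _ => ?_
  rcases eq_or_ne i j with rfl | hij
  · simp
  · rcases eq_or_ne i k with rfl | hik
    · simp only [hij, if_false, Function.update_self, if_true]
      rw [← pow_succ, Nat.sub_add_cancel hk]
    · simp [hij, hik]

theorem sum_prod_div_eq_one [Nonempty ι] {x : ι → K} (hx : Function.Injective x) :
    ∑ k, ∏ j ∈ Finset.univ.erase k, (0 - x j) / (x k - x j) = 1 := by
  have h := congrArg (Polynomial.eval 0)
    (Lagrange.sum_basis (s := Finset.univ) (v := x) hx.injOn Finset.univ_nonempty)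
  rw [Polynomial.eval_finsetSum, Polynomial.eval_one] at h
  rw [← h]
  refine Finset.sum_congr rfl fun k _ => ?_
  rw [Lagrange.basis, Polynomial.eval_prod]
  refine Finset.prod_congr rfl fun j _ => ?_
  simp [Lagrange.basisDivisor, div_eq_mul_inv, mul_comm]

/-- Good's recursion: multiply by the sum of the Lagrange basis polynomials at `0`, which is `1`;
each of them cancels one factor of the Dyson product. -/
theorem dysonProd_eq_sum [Nonempty ι] {a : ι → ℕ} (ha : ∀ i, 0 < a i) {x : ι → K}
    (h0 : ∀ i, x i ≠ 0) :
    dysonProd a x = ∑ k, dysonProd (Function.update a k (a k - 1)) x := by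
  by_cases hx : Function.Injective x
  · rw [← mul_one (dysonProd a x), ← sum_prod_div_eq_one hx, Finset.mul_sum]
    refine Finset.sum_congr rfl fun k _ => ?_
    rw [dysonProd_mul_of_pos x (ha k), mul_assoc, ← Finset.prod_mul_distrib,
      Finset.prod_eq_one, mul_one]
    intro j hj
    have : x k - x j ≠ 0 := sub_ne_zero.2 (hx.ne (Finset.ne_of_mem_erase hj).symm)
    have := h0 j
    field_simp
    ring
  -- If `x i = x j`, both sides vanish: lowering a single exponent leaves `a i` or `a j` untouched,
  -- hence positive.
  · simp only [Function.Injective, not_forall] at hx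
    obtain ⟨i, j, hxij, hij⟩ := hx
    rw [dysonProd_eq_zero hij hxij (h0 j) (ha i).ne', Finset.sum_eq_zero]
    intro k _
    by_cases hki : k = i
    · have hkj : j ≠ k := by rintro rfl; exact hij hki.symm
      refine dysonProd_eq_zero (Ne.symm hij) hxij.symm (h0 i) ?_
      rw [Function.update_of_ne hkj]
      exact (ha j).ne'
    · refine dysonProd_eq_zero hij hxij (h0 j) ?_
      rw [Function.update_of_ne (Ne.symm hki)]
      exact (ha i).ne'

theorem multinomial_eq_sum [Nonempty ι] {a : ι → ℕ} (ha : ∀ i, 0 < a i) :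
    Nat.multinomial Finset.univ a =
      ∑ k, Nat.multinomial Finset.univ (Function.update a k (a k - 1)) := by
  have hS : 0 < ∑ i, a i := Finset.sum_pos (fun i _ => ha i) Finset.univ_nonempty
  -- After multiplication by the total the identity holds term by term, with `a k` as the weight of
  -- the `k`-th term.
  refine Nat.eq_of_mul_eq_mul_left hS ?_
  rw [Finset.mul_sum, Finset.sum_mul]
  refine Finset.sum_congr rfl fun k _ => ?_
  set b := Function.update a k (a k - 1) with hb
  have hsum : ∑ i, a i = ∑ i, b i + 1 := by
    rw [hb, Finset.sum_update_of_mem (Finset.mem_univ k),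
      ← Finset.add_sum_erase _ a (Finset.mem_univ k), Finset.sdiff_singleton_eq_erase]
    have := ha k
    omega
  have hprod : ∏ i, (a i).factorial = a k * ∏ i, (b i).factorial := by
    rw [← Finset.mul_prod_erase _ _ (Finset.mem_univ k),
      ← Finset.mul_prod_erase _ (fun i => (b i).factorial) (Finset.mem_univ k), ← mul_assoc]
    congr 1
    · rw [hb, Function.update_self, Nat.mul_factorial_pred (ha k).ne']
    · refine Finset.prod_congr rfl fun i hi => ?_
      rw [hb, Function.update_of_ne (Finset.ne_of_mem_erase hi)]
  have h1 := Nat.multinomial_spec Finset.univ a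
  have h2 := Nat.multinomial_spec Finset.univ b
  rw [hsum, Nat.factorial_succ, ← hsum, ← h2, hprod] at h1
  refine Nat.eq_of_mul_eq_mul_left
    (Finset.prod_pos fun i _ => Nat.factorial_pos (b i) : 0 < ∏ i, (b i).factorial) ?_
  linarith

end

/-- A variable with exponent zero occurs only in denominators, so the product is a polynomial in
`z⁻¹`, and integrating over `z` keeps its constant term. -/
theorem dysonProd_insertNth {K : Type*} [Field K] {n : ℕ} {a : Fin (n + 1) → ℕ} {i : Fin (n + 1)}
    (hi : a i = 0) (z : K) (y : Fin n → K) :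
    dysonProd a (i.insertNth z y) =
      dysonProd (fun j => a (i.succAbove j)) y * ∏ j, (1 - y j * z⁻¹) ^ a (i.succAbove j) := by
  rw [dysonProd, Fin.prod_univ_succAbove _ i]
  simp only [hi, pow_zero, ite_self, Finset.prod_const_one, one_mul]
  rw [dysonProd, ← Finset.prod_mul_distrib]
  refine Finset.prod_congr rfl fun k _ => ?_
  rw [Fin.prod_univ_succAbove _ i, mul_comm]
  simp [div_eq_mul_inv, (Fin.succAbove_right_injective).eq_iff]

theorem continuous_dysonProd {n : ℕ} (a : Fin n → ℕ) :
    Continuous fun x : Fin n → Circle => dysonProd a fun i => (x i : ℂ) := by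
  unfold dysonProd
  refine continuous_finsetProd _ fun i _ => continuous_finsetProd _ fun j _ => ?_
  split_ifs
  · fun_prop
  · simp_rw [div_eq_mul_inv, ← Circle.coe_inv]
    fun_prop

theorem integral_haarTorus_insertNth {n : ℕ} (i : Fin (n + 1)) {f : (Fin (n + 1) → Circle) → ℂ}
    (hf : Continuous f) :
    ∫ x, f x ∂haarTorus (n + 1) =
      ∫ y, ∫ z, f (i.insertNth z y) ∂haarCircle ∂haarTorus n := by
  have h := (measurePreserving_piFinSuccAbove (fun _ : Fin (n + 1) => haarCircle) i).symm
  rw [haarTorus, ← h.integral_comp' (g := f), integral_prod_symm]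
  · rfl
  · refine integrable_of_continuous (hf.comp ?_)
    exact Continuous.finInsertNth (A := fun _ => Circle) i continuous_fst continuous_snd

/-- Induction on the number of variables and, inside it, on the sum of the exponents: positive
exponents are lowered by Good's recursion, and a variable with zero exponent is integrated out. -/
theorem integral_dysonProd {n : ℕ} (a : Fin n → ℕ) :
    ∫ x : Fin n → Circle, dysonProd a (fun i => (x i : ℂ)) ∂haarTorus n =
      Nat.multinomial Finset.univ a := by
  induction n with
  | zero => simp [dysonProd]
  | succ n ih =>
    induction hS : ∑ i, a i using Nat.strong_induction_on generalizing a with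
    | _ S ihS =>
    by_cases ha : ∀ i, 0 < a i
    · simp_rw [dysonProd_eq_sum ha (x := fun i => _) (fun i => Circle.coe_ne_zero _)]
      rw [integral_finsetSum _ fun k _ => integrable_of_continuous (continuous_dysonProd _),
        multinomial_eq_sum ha, Nat.cast_sum]
      refine Finset.sum_congr rfl fun k _ => ihS _ ?_ _ rfl
      rw [← hS]
      refine Finset.sum_lt_sum (fun i _ => ?_) ⟨k, Finset.mem_univ k, ?_⟩
      · by_cases h : i = k
        · subst h; simp
        · simp [h]
      · simpa using ha k
    · push Not at ha
      obtain ⟨i, hi⟩ := ha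
      replace hi : a i = 0 := by omega
      rw [integral_haarTorus_insertNth i (continuous_dysonProd a)]
      have h : ∀ (y : Fin n → Circle) (z : Circle),
          dysonProd a (fun j => ((i.insertNth z y : Fin (n + 1) → Circle) j : ℂ)) =
            dysonProd (fun j => a (i.succAbove j)) (fun j => (y j : ℂ)) *
              (∏ j, (1 - Polynomial.C (y j : ℂ) * Polynomial.X) ^ a (i.succAbove j)).eval
                (z : ℂ)⁻¹ := by
        intro y z
        rw [Polynomial.eval_prod]
        simp only [Polynomial.eval_pow, Polynomial.eval_sub, Polynomial.eval_one,
          Polynomial.eval_mul, Polynomial.eval_C, Polynomial.eval_X]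
        rw [← dysonProd_insertNth hi]
        congr 1
        ext j
        refine Fin.succAboveCases i ?_ (fun j => ?_) j <;> simp
      simp_rw [h, integral_const_mul, integral_eval_inv_haarCircle]
      simp only [Polynomial.eval_prod, Polynomial.eval_pow, Polynomial.eval_sub,
        Polynomial.eval_one, Polynomial.eval_mul, Polynomial.eval_X, mul_zero, sub_zero, one_pow,
        Finset.prod_const_one, mul_one]
      rw [ih]
      simp [Nat.multinomial, Fin.sum_univ_succAbove _ i, Fin.prod_univ_succAbove _ i, hi]

theorem normSq_sub_eq (z w : Circle) :
    ((‖(z : ℂ) - w‖ ^ 2 : ℝ) : ℂ) = (1 - (z : ℂ) / w) * (1 - (w : ℂ) / z) := by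
  have hz := Circle.coe_ne_zero z
  have hw := Circle.coe_ne_zero w
  rw [Complex.ofReal_pow, ← Complex.mul_conj', map_sub, ← Circle.coe_inv_eq_conj,
    ← Circle.coe_inv_eq_conj, Circle.coe_inv, Circle.coe_inv]
  field_simp

theorem absVandermonde_two_mul (k : ℕ) {M : ℕ} (x : Fin M → Circle) :
    (absVandermonde (2 * k) x : ℂ) = dysonProd (fun _ => k) (fun i => (x i : ℂ)) := by
  have h : ∀ i j : Fin M, ((‖(x j : ℂ) - x i‖ ^ (2 * k) : ℝ) : ℂ) =
      (1 - (x i : ℂ) / x j) ^ k * (1 - (x j : ℂ) / x i) ^ k := by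
    intro i j
    rw [pow_mul, Complex.ofReal_pow, normSq_sub_eq, ← mul_pow, mul_comm]
  simp_rw [absVandermonde, Complex.ofReal_prod, h, Finset.prod_mul_distrib]
  -- Each unordered pair supplies two factors; regrouping the second one by its numerator gives one
  -- factor per ordered pair.
  rw [Finset.prod_comm' (t' := Finset.univ) (s' := fun j => Finset.Iio j)
    (f := fun i j => (1 - (x j : ℂ) / x i) ^ k) (by simp), ← Finset.prod_mul_distrib, dysonProd]
  refine Finset.prod_congr rfl fun i _ => ?_
  rw [← Finset.prod_union]
  · rw [← Finset.prod_subset (Finset.subset_univ (Finset.Ioi i ∪ Finset.Iio i))]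
    · refine Finset.prod_congr rfl fun j hj => ?_
      rw [if_neg]
      rintro rfl
      simp at hj
    · intro j _ hj
      simp only [Finset.mem_union, Finset.mem_Ioi, Finset.mem_Iio, not_or, not_lt] at hj
      rw [if_pos (le_antisymm hj.2 hj.1)]
  · rw [Finset.disjoint_left]
    intro j h1 h2
    simp only [Finset.mem_Ioi, Finset.mem_Iio] at h1 h2
    exact lt_asymm h1 h2

theorem integral_absVandermonde (k M : ℕ) :
    ∫ x : Fin M → Circle, absVandermonde (2 * k) x ∂haarTorus M =
      Nat.multinomial Finset.univ fun _ : Fin M => k := by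
  have h := integral_dysonProd (fun _ : Fin M => k)
  simp_rw [← absVandermonde_two_mul] at h
  rw [integral_complex_ofReal] at h
  exact_mod_cast h

/-! ### The confluent Vandermonde determinant -/

/-- The `l`-th divided derivative at `x` of the vector `(1, X, …, X^{N-1})`. -/
def confluentVector {R : Type*} [CommRing R] (N : ℕ) (x : R) (l : ℕ) : Fin N → R :=
  fun n => ((n : ℕ).choose l : R) * x ^ ((n : ℕ) - l)

/-- The block of length `L` that contains the index `q`. -/
def blockIndex {L K : ℕ} (q : Fin (L * K)) : Fin K := ⟨q / L, Nat.div_lt_of_lt_mul q.2⟩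

/-- Multiplying the confluent matrix by a matrix of polynomial coefficients thus yields Taylor
coefficients at the nodes. -/
theorem sum_confluentVector_mul_coeff {R : Type*} [CommRing R] {N : ℕ} (x : R) (l : ℕ)
    {p : Polynomial R} (hp : p.natDegree < N) :
    ∑ n : Fin N, confluentVector N x l n * p.coeff n = (Polynomial.taylor x p).coeff l := by
  conv_rhs => rw [p.as_sum_range' N hp]
  rw [map_sum, Polynomial.finsetSum_coeff,
    ← Fin.sum_univ_eq_sum_range (fun n => (Polynomial.taylor x
      (Polynomial.monomial n (p.coeff n))).coeff l)]
  refine Finset.sum_congr rfl fun n _ => ?_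
  rw [Polynomial.taylor_monomial, Polynomial.coeff_C_mul, Polynomial.coeff_X_add_C_pow,
    confluentVector]
  ring

/-- The Newton basis polynomial `∏_{j < i} (X - x_j)^L (X - x_i)^l`, where `q = L i + l`. -/
def newtonPolynomial {R : Type*} [CommRing R] {L K : ℕ} (x : Fin K → R) (q : Fin (L * K)) :
    Polynomial R :=
  (∏ j ∈ Finset.Iio (blockIndex q), (Polynomial.X - Polynomial.C (x j)) ^ L) *
    (Polynomial.X - Polynomial.C (x (blockIndex q))) ^ ((q : ℕ) % L)

section

variable {R : Type*} [CommRing R] {L K : ℕ} (x : Fin K → R)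

theorem monic_newtonPolynomial (q : Fin (L * K)) : (newtonPolynomial x q).Monic :=
  (Polynomial.monic_prod_of_monic _ _ fun j _ => (Polynomial.monic_X_sub_C (x j)).pow L).mul
    ((Polynomial.monic_X_sub_C _).pow _)

theorem natDegree_newtonPolynomial [Nontrivial R] (q : Fin (L * K)) :
    (newtonPolynomial x q).natDegree = q := by
  rw [newtonPolynomial, Polynomial.Monic.natDegree_mul
    (Polynomial.monic_prod_of_monic _ _ fun j _ => (Polynomial.monic_X_sub_C (x j)).pow L)
    ((Polynomial.monic_X_sub_C _).pow _),
    Polynomial.natDegree_prod_of_monic _ _ fun j _ => (Polynomial.monic_X_sub_C (x j)).pow L]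
  simp_rw [(Polynomial.monic_X_sub_C _).natDegree_pow, Polynomial.natDegree_X_sub_C]
  simp only [Finset.sum_const, Fin.card_Iio, blockIndex, mul_one, smul_eq_mul]
  exact Nat.div_add_mod' _ _

/-- The later Newton polynomial vanishes at the node of `q` to order at least `L` if its block is
later, and to order `r % L > q % L` if the block is the same. -/
theorem taylor_newtonPolynomial_coeff_of_lt {q r : Fin (L * K)} (h : q < r) :
    (Polynomial.taylor (x (blockIndex q)) (newtonPolynomial x r)).coeff ((q : ℕ) % L) = 0 := by
  have hL : 0 < L := Nat.pos_of_ne_zero (by rintro rfl; have := q.2; simp at this)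
  have key : ∀ d : ℕ, (q : ℕ) % L < d →
      (Polynomial.X - Polynomial.C (x (blockIndex q))) ^ d ∣ newtonPolynomial x r →
      (Polynomial.taylor (x (blockIndex q)) (newtonPolynomial x r)).coeff ((q : ℕ) % L) = 0 := by
    rintro d hd ⟨p, hp⟩
    rw [hp, Polynomial.taylor_mul, Polynomial.taylor_pow, map_sub, Polynomial.taylor_X,
      Polynomial.taylor_C, add_sub_cancel_right, Polynomial.coeff_X_pow_mul', if_neg (by omega)]
  have hle : (q : ℕ) / L ≤ r / L := Nat.div_le_div_right h.le
  rcases hle.lt_or_eq with hlt | heq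
  · refine key L (Nat.mod_lt _ hL) (Dvd.dvd.mul_right ?_ _)
    exact Finset.dvd_prod_of_mem (fun j => (Polynomial.X - Polynomial.C (x j)) ^ L)
      (Finset.mem_Iio.2 (show blockIndex q < blockIndex r from hlt))
  · have hb : blockIndex q = blockIndex r := Fin.ext heq
    refine key (r % L) ?_ (hb ▸ Dvd.intro_left _ rfl)
    have h1 := Nat.div_add_mod (q : ℕ) L
    have h2 := Nat.div_add_mod (r : ℕ) L
    rw [heq] at h1
    have : (q : ℕ) < r := h
    omega

theorem taylor_newtonPolynomial_coeff_self (q : Fin (L * K)) :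
    (Polynomial.taylor (x (blockIndex q)) (newtonPolynomial x q)).coeff ((q : ℕ) % L) =
      ∏ j ∈ Finset.Iio (blockIndex q), (x (blockIndex q) - x j) ^ L := by
  rw [newtonPolynomial, Polynomial.taylor_mul, Polynomial.taylor_pow, map_sub, Polynomial.taylor_X,
    Polynomial.taylor_C, add_sub_cancel_right, Polynomial.coeff_mul_X_pow', if_pos le_rfl,
    Nat.sub_self, Polynomial.taylor_coeff_zero, Polynomial.eval_prod]
  simp

theorem prod_comp_blockIndex {α : Type*} [CommMonoid α] (f : Fin K → α) :
    ∏ q : Fin (L * K), f (blockIndex q) = ∏ i, f i ^ L := by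
  rw [← (finProdFinEquiv.trans (finCongr (Nat.mul_comm K L))).prod_comp, Fintype.prod_prod_type]
  refine Finset.prod_congr rfl fun i _ => ?_
  rw [Finset.prod_congr rfl (g := fun _ => f i), Finset.prod_const, Finset.card_univ,
    Fintype.card_fin]
  intro l _
  congr 1
  ext
  have := l.2
  simp [blockIndex, Nat.add_mul_div_left _ _ (by omega : 0 < L), Nat.div_eq_of_lt l.2]

/-- Passing from monomials to the Newton basis multiplies by a matrix of determinant `1` and makes
the confluent matrix lower triangular. Each of the `L` rows of a block has the same diagonal entry,
which turns exponent `L` into `L ^ 2`. -/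
theorem det_confluentVandermonde [Nontrivial R] :
    (Matrix.of fun q : Fin (L * K) =>
      confluentVector (L * K) (x (blockIndex q)) ((q : ℕ) % L)).det =
      ∏ i, ∏ j ∈ Finset.Ioi i, (x j - x i) ^ (L ^ 2) := by
  have hP := Matrix.det_matrixOfPolynomials (newtonPolynomial (L := L) x)
    (natDegree_newtonPolynomial x) (monic_newtonPolynomial x)
  rw [← mul_one (Matrix.det _), ← hP, ← Matrix.det_mul, Matrix.det_of_isLowerTriangular]
  · simp only [Matrix.mul_apply, Matrix.of_apply, sum_confluentVector_mul_coeff _ _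
      ((natDegree_newtonPolynomial x _).trans_lt (Fin.is_lt _)), taylor_newtonPolynomial_coeff_self]
    rw [prod_comp_blockIndex fun b => ∏ j ∈ Finset.Iio b, (x b - x j) ^ L]
    simp_rw [← Finset.prod_pow, ← pow_mul, ← sq]
    exact Finset.prod_comm' (by simp)
  · intro q r h
    simp only [Matrix.mul_apply, Matrix.of_apply]
    rw [sum_confluentVector_mul_coeff _ _
      ((natDegree_newtonPolynomial x _).trans_lt (Fin.is_lt _))]
    exact taylor_newtonPolynomial_coeff_of_lt x h

end

/-! ### Expansion of the confluent blocks -/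

/-- Falling factorials are monic of degree `l`, so they may replace the powers in a Vandermonde
determinant. -/
theorem prod_factorial_mul_det_choose {L : ℕ} (u : Fin L → ℕ) :
    (∏ l : Fin L, ((l : ℕ).factorial : ℂ)) *
        (Matrix.of fun k l : Fin L => ((u k).choose l : ℂ)).det =
      ∏ j : Fin L, ∏ k ∈ Finset.Ioi j, ((u k : ℂ) - (u j : ℂ)) := by
  rw [← Matrix.det_vandermonde, Matrix.det_eval_matrixOfPolynomials_eq_det_vandermonde _
    (fun i : Fin L => descPochhammer ℂ i) (fun i => descPochhammer_natDegree ℂ i)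
    (fun i => monic_descPochhammer ℂ i), ← Matrix.det_mul_row]
  congr 1
  ext k l
  rw [Matrix.of_apply, Matrix.of_apply, Matrix.of_apply, descPochhammer_eval_eq_descFactorial,
    Nat.descFactorial_eq_factorial_mul_choose, Nat.cast_mul]

theorem det_choose_eq_normVandermonde {N L : ℕ} (u : Fin L → Fin N) :
    (Matrix.of fun k l : Fin L => ((u k : ℕ).choose l : ℂ)).det = normVandermonde u := by
  have h1 := prod_factorial_mul_det_choose fun k => (u k : ℕ)
  -- The case `u = id`, with a unitriangular binomial matrix, evaluates the denominator of
  -- `normVandermonde`.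
  have h2 := prod_factorial_mul_det_choose fun k : Fin L => (k : ℕ)
  have hid : (Matrix.of fun k l : Fin L => ((k : ℕ).choose l : ℂ)).det = 1 := by
    rw [Matrix.det_of_isLowerTriangular]
    · simp
    · intro i j hij
      have : (i : ℕ) < j := hij
      simp [Nat.choose_eq_zero_of_lt this]
  rw [hid, mul_one] at h2
  have h0 : (∏ l : Fin L, ((l : ℕ).factorial : ℂ)) ≠ 0 :=
    Finset.prod_ne_zero_iff.2 fun l _ => by exact_mod_cast Nat.factorial_ne_zero _
  simp_rw [normVandermonde, Finset.prod_div_distrib]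
  rw [← h1, ← h2, mul_div_cancel_left₀ _ h0]

open Classical in
theorem ιMulti_eq_sum_det {N L : ℕ} (v : Fin L → Fin N → ℂ) :
    ExteriorAlgebra.ιMulti ℂ L v =
      ∑ u : Fin L → Fin N with StrictMono u,
        (Matrix.of fun i k => v i (u k)).det • basisVector u := by
  have h := ((Pi.basisFun ℂ (Fin N)).exteriorPower L).sum_repr (exteriorPower.ιMulti ℂ L v)
  have h' := congrArg (Submodule.subtype _) h
  rw [map_sum] at h'
  simp only [map_smul, Submodule.subtype_apply, exteriorPower.ιMulti_apply_coe] at h'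
  rw [← h']
  symm
  refine Finset.sum_bij' (fun u hu => Set.powersetCard.ofFinEmbEquiv
      (OrderEmbedding.ofStrictMono u (Finset.mem_filter.1 hu).2))
    (fun s _ => Set.powersetCard.ofFinEmbEquiv.symm s) ?_ ?_ ?_ ?_ ?_
  · simp
  · intro s _
    simpa using (Set.powersetCard.ofFinEmbEquiv.symm s).strictMono
  · intro u hu
    simp
  · intro s _
    apply Set.powersetCard.ofFinEmbEquiv.symm.injective
    ext
    simp
  · intro u hu
    rw [exteriorPower.basis_repr_apply, exteriorPower.ιMultiDual_apply_ιMulti,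
      exteriorPower.basis_apply, exteriorPower.ιMulti_family_apply_coe,
      ExteriorAlgebra.ιMulti_family, basisVector, Equiv.symm_apply_apply]
    congr 2
    ext k
    simp

/-- The `L`-vector of a confluent block at `x`. -/
def confluentWedge (N L : ℕ) (x : ℂ) : Ext N :=
  ExteriorAlgebra.ιMulti ℂ L fun l : Fin L => confluentVector N x l

theorem zpow_sum {ι G : Type*} [CommGroupWithZero G] {x : G} (hx : x ≠ 0) (s : Finset ι)
    (n : ι → ℤ) : x ^ (∑ i ∈ s, n i) = ∏ i ∈ s, x ^ n i := by
  classical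
  induction s using Finset.induction_on with
  | empty => simp
  | insert a s ha ih => rw [Finset.sum_insert ha, Finset.prod_insert ha, zpow_add₀ hx, ih]

open Classical in
theorem confluentWedge_eq_sum (N L : ℕ) {x : ℂ} (hx : x ≠ 0) :
    confluentWedge N L x = ∑ u : Fin L → Fin N with StrictMono u,
      (x ^ (∑ k, ((u k : ℕ) : ℤ) - ∑ l : Fin L, ((l : ℕ) : ℤ)) * normVandermonde u) •
        basisVector u := by
  rw [confluentWedge, ιMulti_eq_sum_det]
  refine Finset.sum_congr rfl fun u _ => ?_
  congr 1
  rw [← det_choose_eq_normVandermonde, ← Matrix.det_transpose]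
  have h : (Matrix.of fun (i k : Fin L) => confluentVector N x i (u k)).transpose =
      Matrix.of fun k l : Fin L => x ^ ((u k : ℕ) : ℤ) * (Matrix.of fun k l : Fin L => x ^ (-((l : ℕ) : ℤ)) *
        (Matrix.of fun k l : Fin L => ((u k : ℕ).choose l : ℂ)) k l) k l := by
    ext k l
    simp only [Matrix.transpose_apply, Matrix.of_apply, confluentVector]
    -- The truncated exponent `u k - l` is harmless: where it truncates, the binomial coefficient is
    -- zero.
    rcases le_or_gt (l : ℕ) (u k) with hle | hlt
    · rw [← zpow_natCast x (_ - _), Nat.cast_sub hle, sub_eq_add_neg, zpow_add₀ hx]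
      ring
    · simp [Nat.choose_eq_zero_of_lt hlt]
  rw [h, Matrix.det_mul_column, Matrix.det_mul_row, ← mul_assoc, sub_eq_add_neg, zpow_add₀ hx,
    ← Finset.sum_neg_distrib, zpow_sum hx, zpow_sum hx]

theorem volumeCoeff_prod_confluentWedge {L K : ℕ} (x : Fin K → ℂ) :
    volumeCoeff (L * K) (List.ofFn fun i => confluentWedge (L * K) L (x i)).prod =
      ∏ i, ∏ j ∈ Finset.Ioi i, (x j - x i) ^ (L ^ 2) := by
  have h : (List.ofFn fun i => confluentWedge (L * K) L (x i)).prod =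
      ExteriorAlgebra.ιMulti ℂ (L * K) fun q : Fin (L * K) =>
        confluentVector (L * K) (x (blockIndex q)) ((q : ℕ) % L) := by
    rw [ExteriorAlgebra.ιMulti_apply, List.ofFn_mul', List.prod_flatten, List.map_ofFn]
    congr 2
    ext i
    rw [confluentWedge, ExteriorAlgebra.ιMulti_apply, Function.comp_apply]
    congr 2
    ext l
    have hL : 0 < L := by have := l.2; omega
    congr 2
    · simp [blockIndex, Nat.mul_add_div hL, Nat.div_eq_of_lt l.2]
    · simp [Nat.mod_eq_of_lt l.2]
  rw [h, ← det_confluentVandermonde, volumeCoeff, ExteriorAlgebra.liftAlternating_apply_ιMulti,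
    Pi.single_eq_same]
  rfl

/-! ### The correlation functions -/

theorem continuous_absVandermonde (β M : ℕ) :
    Continuous fun x : Fin M → Circle => absVandermonde β x := by
  unfold absVandermonde
  fun_prop

theorem absVandermonde_nonneg (β : ℕ) {M : ℕ} (x : Fin M → Circle) : 0 ≤ absVandermonde β x :=
  Finset.prod_nonneg fun _ _ => Finset.prod_nonneg fun _ _ => by positivity

theorem continuous_jointDensity (β M : ℕ) :
    Continuous fun x : Fin M → Circle => jointDensity β x :=
  (continuous_absVandermonde β M).const_mul _

theorem partitionFunction_nonneg (β M : ℕ) : 0 ≤ partitionFunction β M :=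
  mul_nonneg (by positivity) (integral_nonneg fun x => absVandermonde_nonneg β x)

theorem jointDensity_nonneg (β : ℕ) {M : ℕ} (x : Fin M → Circle) : 0 ≤ jointDensity β x :=
  mul_nonneg (one_div_nonneg.2 (mul_nonneg (by positivity) (partitionFunction_nonneg β M)))
    (absVandermonde_nonneg β x)

theorem dysonProd_const_comp_equiv {ι ι' K : Type*} [Fintype ι] [DecidableEq ι] [Fintype ι']
    [DecidableEq ι'] [Field K] (k : ℕ) (x : ι → K) (σ : ι' ≃ ι) :
    dysonProd (fun _ => k) (x ∘ σ) = dysonProd (fun _ => k) x := by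
  unfold dysonProd
  conv_rhs => rw [← Equiv.prod_comp σ]
  refine Finset.prod_congr rfl fun i _ => ?_
  conv_rhs => rw [← Equiv.prod_comp σ]
  simp

/-- The Dyson form runs over all ordered pairs, so its symmetry is visible, unlike that of the
product over `j < k`. -/
theorem jointDensity_comp_perm (k : ℕ) {M : ℕ} (x : Fin M → Circle) (σ : Equiv.Perm (Fin M)) :
    jointDensity (2 * k) (x ∘ σ) = jointDensity (2 * k) x := by
  have h : absVandermonde (2 * k) (x ∘ σ) = absVandermonde (2 * k) x := by
    apply Complex.ofReal_injective
    rw [absVandermonde_two_mul, absVandermonde_two_mul]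
    exact dysonProd_const_comp_equiv k (fun i => (x i : ℂ)) σ
  rw [jointDensity, jointDensity, h]

theorem measurePreserving_comp_perm {M : ℕ} (σ : Equiv.Perm (Fin M)) :
    MeasurePreserving (fun x : Fin M → Circle => x ∘ σ) (haarTorus M) (haarTorus M) := by
  have h := measurePreserving_piCongrLeft (fun _ : Fin M => haarCircle) σ.symm
  simp only [haarTorus]
  convert h using 1
  ext x i
  have := Equiv.piCongrLeft_apply_apply (P := fun _ => Circle) σ.symm x (σ i)
  simp only [Equiv.symm_apply_apply] at this
  simp [MeasurableEquiv.coe_piCongrLeft, this]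

theorem measurePreserving_concat {m M : ℕ} (h : m ≤ M) :
    MeasurePreserving (fun p : (Fin m → Circle) × (Fin (M - m) → Circle) => concat h p.1 p.2)
      ((haarTorus m).prod (haarTorus (M - m))) (haarTorus M) := by
  let e : Fin m ⊕ Fin (M - m) ≃ Fin M := finSumFinEquiv.trans (finCongr (Nat.add_sub_of_le h))
  have h1 := measurePreserving_piCongrLeft (fun _ : Fin M => haarCircle) e
  have h2 := measurePreserving_sumPiEquivProdPi_symm
    (fun _ : Fin m ⊕ Fin (M - m) => haarCircle)
  simp only [haarTorus]
  convert h1.comp h2 using 1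
  ext p i
  obtain ⟨i, rfl⟩ := e.surjective i
  rw [Function.comp_apply, MeasurableEquiv.coe_piCongrLeft,
    Equiv.piCongrLeft_apply_apply (P := fun _ => Circle)]
  rcases i with i | i <;> simp [e, concat, MeasurableEquiv.sumPiEquivProdPi]

theorem occupation_eq_sum_indicator {M : ℕ} (B : Set Circle) (x : Fin M → Circle) :
    (occupation B x : ENNReal) = ∑ k, B.indicator 1 (x k) := by
  classical
  rw [occupation, Set.ncard_eq_toFinset_card', Finset.card_eq_sum_ones, Nat.cast_sum,
    Set.toFinset_ofPred, Finset.sum_filter]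
  refine Finset.sum_congr rfl fun k _ => ?_
  by_cases hk : x k ∈ B <;> simp [hk]

theorem exists_perm_castLE_eq {m M : ℕ} (h : m ≤ M) {φ : Fin m → Fin M}
    (hφ : Function.Injective φ) : ∃ σ : Equiv.Perm (Fin M), ∀ i, σ (Fin.castLE h i) = φ i := by
  have := Equiv.Perm.isMultiplyPretransitive (Fin M) m
  obtain ⟨σ, hσ⟩ := MulAction.exists_smul_eq (Equiv.Perm (Fin M)) (Fin.castLEEmb h)
    (⟨φ, hφ⟩ : Fin m ↪ Fin M)
  exact ⟨σ, fun i => congrArg (fun f : Fin m ↪ Fin M => f i) hσ⟩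

/-- Expanding the product gives a sum over all index maps; the non-injective ones drop out because
one particle cannot lie in two disjoint sets. -/
theorem prod_occupation_eq_sum {m M : ℕ} {B : Fin m → Set Circle}
    (hB : Pairwise fun i j => Disjoint (B i) (B j)) (x : Fin M → Circle) :
    ∏ i, (occupation (B i) x : ENNReal) =
      ∑ φ : Fin m ↪ Fin M, ∏ i, (B i).indicator 1 (x (φ i)) := by
  classical
  simp_rw [occupation_eq_sum_indicator]
  rw [Finset.prod_univ_sum, Fintype.piFinset_univ]
  symm
  refine Finset.sum_of_injOn (fun φ : Fin m ↪ Fin M => ⇑φ) DFunLike.coe_injective.injOn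
    (by simp [Set.MapsTo]) ?_ (fun _ _ => rfl)
  intro φ _ hφ
  have hinj : ¬ Function.Injective φ := fun hi => hφ ⟨⟨φ, hi⟩, by simp, rfl⟩
  simp only [Function.Injective, not_forall] at hinj
  obtain ⟨i, j, hij, hne⟩ := hinj
  by_cases hi : x (φ i) ∈ B i
  · refine Finset.prod_eq_zero (Finset.mem_univ j) (Set.indicator_of_notMem ?_ _)
    rw [← hij]
    exact Set.disjoint_left.1 (hB hne) hi
  · exact Finset.prod_eq_zero (Finset.mem_univ i) (Set.indicator_of_notMem hi _)

theorem measurable_prod_indicator {m M : ℕ} {B : Fin m → Set Circle}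
    (hB : ∀ i, MeasurableSet (B i)) (φ : Fin m → Fin M) :
    Measurable fun x : Fin M → Circle => ∏ i, (B i).indicator (1 : Circle → ENNReal) (x (φ i)) :=
  Finset.measurable_prod _ fun i _ =>
    (measurable_one.indicator (hB i)).comp (measurable_pi_apply _)

theorem ofReal_correlation (β : ℕ) {m M : ℕ} (h : m ≤ M) (y : Fin m → Circle) :
    ENNReal.ofReal (correlation β h y) = (M.descFactorial m : ENNReal) *
      ∫⁻ x, ENNReal.ofReal (jointDensity β (concat h y x)) ∂haarTorus (M - m) := by
  have hc : Continuous fun x => concat h y x := by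
    unfold concat
    refine continuous_pi fun i => ?_
    refine Fin.addCases (fun j => ?_) (fun j => ?_) (Fin.cast (Nat.add_sub_of_le h).symm i)
    · simp only [Fin.append_left]
      fun_prop
    · simp only [Fin.append_right]
      fun_prop
  have hd : (M.factorial : ℝ) / ((M - m).factorial : ℝ) = (M.descFactorial m : ℕ) := by
    rw [div_eq_iff (by exact_mod_cast Nat.factorial_ne_zero _), ← Nat.factorial_mul_descFactorial h]
    push_cast
    ring
  rw [correlation, hd, ENNReal.ofReal_mul (by positivity), ENNReal.ofReal_natCast,
    ofReal_integral_eq_lintegral_ofReal (f := fun x => jointDensity β (concat h y x))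
      (integrable_of_continuous ((continuous_jointDensity β M).comp hc))
      (ae_of_all _ fun x => jointDensity_nonneg β _)]

theorem isCorrelationFunction_correlation (k : ℕ) {m M : ℕ} (h : m ≤ M) :
    IsCorrelationFunction (law (2 * k) M) m (correlation (2 * k) h) where
  nonneg y := mul_nonneg (by positivity) (integral_nonneg fun x => jointDensity_nonneg _ _)
  measurable := by
    refine Measurable.const_mul (StronglyMeasurable.measurable ?_) _
    refine StronglyMeasurable.integral_prod_right
      (f := fun y x => jointDensity (2 * k) (concat h y x)) (Measurable.stronglyMeasurable ?_)
    exact (continuous_jointDensity (2 * k) M).measurable.comp (measurePreserving_concat h).measurable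
  expectation_eq B hB hdisj := by
    have hg : Measurable fun x : Fin M → Circle => ENNReal.ofReal (jointDensity (2 * k) x) :=
      (continuous_jointDensity (2 * k) M).measurable.ennreal_ofReal
    have hG : ∀ φ : Fin m → Fin M, Measurable fun x : Fin M → Circle =>
        ENNReal.ofReal (jointDensity (2 * k) x) *
          ∏ i, (B i).indicator (1 : Circle → ENNReal) (x (φ i)) :=
      fun φ => hg.mul (measurable_prod_indicator hB φ)
    simp_rw [prod_occupation_eq_sum hdisj]
    have hsum : Measurable fun x : Fin M → Circle =>
        ∑ φ : Fin m ↪ Fin M, ∏ i, (B i).indicator (1 : Circle → ENNReal) (x (φ i)) :=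
      Finset.measurable_sum _ fun φ _ => measurable_prod_indicator hB φ
    rw [law, lintegral_withDensity_eq_lintegral_mul _ hg hsum]
    simp only [Pi.mul_apply, Finset.mul_sum]
    rw [lintegral_finsetSum _ fun (φ : Fin m ↪ Fin M) _ => hG φ]
    -- A permutation carries the first `m` labels to the values of `φ`, and both density and measure
    -- are invariant under it. The number of injections is the factor `M! / (M - m)!`.
    have hsymm : ∀ φ : Fin m ↪ Fin M,
        ∫⁻ x, ENNReal.ofReal (jointDensity (2 * k) x) * ∏ i, (B i).indicator 1 (x (φ i))
          ∂haarTorus M =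
        ∫⁻ x, ENNReal.ofReal (jointDensity (2 * k) x) *
          ∏ i, (B i).indicator 1 (x (Fin.castLE h i)) ∂haarTorus M := by
      intro φ
      obtain ⟨σ, hσ⟩ := exists_perm_castLE_eq h φ.injective
      rw [← (measurePreserving_comp_perm σ).lintegral_comp
        (hG (Fin.castLE h))]
      simp only [jointDensity_comp_perm, Function.comp_apply, hσ]
    simp_rw [hsymm]
    rw [Finset.sum_const, Finset.card_univ, Fintype.card_embedding_eq, Fintype.card_fin,
      Fintype.card_fin, nsmul_eq_mul, ← (measurePreserving_concat h).lintegral_comp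
        (hG (Fin.castLE h))]
    have hmeas := (hG (Fin.castLE h)).comp
      (measurePreserving_concat h).measurable
    have hind : ∀ (y : Fin m → Circle) (x : Fin (M - m) → Circle),
        ∏ i, (B i).indicator (1 : Circle → ENNReal) (concat h y x (Fin.castLE h i)) =
          (Set.univ.pi B).indicator 1 y := by
      intro y x
      have hc : ∀ i, concat h y x (Fin.castLE h i) = y i := fun i => Fin.append_left y x i
      simp_rw [hc]
      by_cases hy : y ∈ Set.univ.pi B
      · rw [Set.indicator_of_mem hy]
        exact Finset.prod_eq_one fun i _ => Set.indicator_of_mem (hy i trivial) _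
      · rw [Set.indicator_of_notMem hy]
        simp only [Set.mem_pi, Set.mem_univ, true_imp_iff, not_forall] at hy
        obtain ⟨i, hi⟩ := hy
        exact Finset.prod_eq_zero (Finset.mem_univ i) (Set.indicator_of_notMem hi _)
    simp only [Function.comp_def, hind] at hmeas ⊢
    rw [lintegral_prod _ hmeas.aemeasurable, ← lintegral_const_mul' _ _ (ENNReal.natCast_ne_top _),
      ← lintegral_indicator (MeasurableSet.univ_pi hB)]
    refine lintegral_congr fun y => ?_
    by_cases hy : y ∈ Set.univ.pi B
    · simp [Set.indicator_of_mem hy, ofReal_correlation]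
    · simp [Set.indicator_of_notMem hy]

/-! ### Laurent polynomials on the circle -/

/-- Evaluation of Laurent polynomials at a point of the circle. -/
def laurentEval (z : Circle) : LaurentPolynomial ℂ →+* ℂ :=
  LaurentPolynomial.eval₂ (RingHom.id ℂ) (Units.mk0 (z : ℂ) (Circle.coe_ne_zero z))

theorem laurentEval_T (z : Circle) (n : ℤ) :
    laurentEval z (LaurentPolynomial.T n) = (z : ℂ) ^ n := by
  simp [laurentEval]

theorem laurentEval_C (z : Circle) (a : ℂ) : laurentEval z (LaurentPolynomial.C a) = a := by
  simp [laurentEval]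

theorem continuous_coe_zpow (n : ℤ) : Continuous fun z : Circle => (z : ℂ) ^ n := by
  simp_rw [← Circle.coe_zpow]
  exact continuous_subtype_val.comp (continuous_zpow n)

theorem continuous_laurentEval (p : LaurentPolynomial ℂ) :
    Continuous fun z => laurentEval z p := by
  induction p using LaurentPolynomial.induction_on' with
  | add p q hp hq => simp_rw [map_add]; exact hp.add hq
  | C_mul_T n a =>
    simp_rw [map_mul, laurentEval_C, laurentEval_T]
    exact (continuous_coe_zpow n).const_mul a

theorem integral_zpow_mul_laurentEval (p : LaurentPolynomial ℂ) (j : ℤ) :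
    ∫ z : Circle, (z : ℂ) ^ (-j) * laurentEval z p ∂haarCircle = p.coeff j := by
  induction p using LaurentPolynomial.induction_on' with
  | add p q hp hq =>
    simp_rw [map_add, mul_add]
    rw [integral_add, hp, hq]
    · simp
    · exact integrable_of_continuous ((continuous_coe_zpow _).mul (continuous_laurentEval p))
    · exact integrable_of_continuous ((continuous_coe_zpow _).mul (continuous_laurentEval q))
  | C_mul_T n a =>
    have h : ∀ z : Circle, (z : ℂ) ^ (-j) * laurentEval z
        (LaurentPolynomial.C a * LaurentPolynomial.T n) = a * (z : ℂ) ^ (n - j) := by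
      intro z
      rw [map_mul, laurentEval_C, laurentEval_T, sub_eq_add_neg,
        zpow_add₀ (Circle.coe_ne_zero z)]
      ring
    simp_rw [h, integral_const_mul, integral_zpow_haarCircle, sub_eq_zero,
      ← LaurentPolynomial.smul_eq_C_mul]
    simp

theorem laurentEval_fPow (β : ℕ) {m : ℕ} (y : Fin m → Circle) (z : Circle) :
    laurentEval z (fPow β y) =
      (z : ℂ) ^ (-((β / 2 * m : ℕ) : ℤ)) * ∏ n, ((z : ℂ) - y n) ^ β := by
  simp only [fPow, map_mul, map_prod, map_pow, map_sub, laurentEval_T, laurentEval_C, zpow_one]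

/-- This lets the truncated sum over `j` in `fPowEpsilon` account for every subset, whatever its
excess. -/
theorem coeff_fPow_eq_zero (k : ℕ) {m : ℕ} (y : Fin m → Circle) {j : ℤ}
    (hj : j ∉ Finset.Icc (-((k * m : ℕ) : ℤ)) ((k * m : ℕ) : ℤ)) :
    (fPow (2 * k) y).coeff j = 0 := by
  set q : Polynomial ℂ := ∏ n, (Polynomial.X - Polynomial.C (y n : ℂ)) ^ (2 * k) with hq
  have hdeg : q.natDegree = 2 * k * m := by
    rw [hq, Polynomial.natDegree_prod_of_monic _ _ fun n _ => (Polynomial.monic_X_sub_C _).pow _]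
    simp_rw [(Polynomial.monic_X_sub_C _).natDegree_pow, Polynomial.natDegree_X_sub_C]
    simp [mul_comm]
  have hf : fPow (2 * k) y =
      LaurentPolynomial.T (-((k * m : ℕ) : ℤ)) * Polynomial.toLaurent q := by
    rw [fPow, hq, map_prod, Nat.mul_div_cancel_left k two_pos]
    simp [Polynomial.toLaurent_X, Polynomial.toLaurent_C]
  have hc : (fPow (2 * k) y).coeff j = (Polynomial.toLaurent q).coeff (j + (k * m : ℕ)) := by
    rw [hf, ← integral_zpow_mul_laurentEval, ← integral_zpow_mul_laurentEval]
    refine integral_congr_ae (ae_of_all _ fun z => ?_)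
    simp only [map_mul, laurentEval_T, neg_add, zpow_add₀ (Circle.coe_ne_zero z), mul_assoc]
  rw [hc]
  by_contra h
  have hmem := Finsupp.mem_support_iff.2 h
  rw [LaurentPolynomial.support_coeff_toLaurent, Finset.mem_map] at hmem
  obtain ⟨i, hi, hij⟩ := hmem
  have hi' := Polynomial.le_natDegree_of_mem_supp i hi
  rw [hdeg] at hi'
  replace hij : (i : ℤ) = j + (k * m : ℕ) := hij
  apply hj
  rw [Finset.mem_Icc]
  have : 2 * k * m = k * m + k * m := by ring
  omega

/-! ### Factorization of the integrand -/

theorem dysonProd_const_sum {ι κ K : Type*} [Fintype ι] [DecidableEq ι] [Fintype κ]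
    [DecidableEq κ] [Field K] (k : ℕ) (y : ι → K) (x : κ → K) :
    dysonProd (fun _ => k) (Sum.elim y x) = dysonProd (fun _ => k) y * dysonProd (fun _ => k) x *
      ∏ i, ∏ n, ((1 - x i / y n) * (1 - y n / x i)) ^ k := by
  simp only [dysonProd, Fintype.prod_sum_type, Sum.elim_inl, Sum.elim_inr, Sum.inl.injEq,
    Sum.inr.injEq, reduceCtorEq, if_false, Finset.prod_mul_distrib, mul_pow]
  rw [Finset.prod_comm (f := fun i n => (1 - y n / x i) ^ k)]
  ring

/-- Evenness of `k` removes the sign `(-1)^k`; this is where the parity of `L` enters. -/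
theorem one_sub_div_mul_one_sub_div_pow {K : Type*} [Field K] {k : ℕ} (hk : Even k) {a b : K}
    (ha : a ≠ 0) (hb : b ≠ 0) :
    ((1 - a / b) * (1 - b / a)) ^ k = (a - b) ^ (2 * k) * (a ^ k)⁻¹ * (b ^ k)⁻¹ := by
  have h : (1 - a / b) * (1 - b / a) = -((a - b) ^ 2 * a⁻¹ * b⁻¹) := by
    field_simp
    ring
  rw [h, hk.neg_pow, mul_pow, mul_pow, inv_pow, inv_pow, ← pow_mul]

theorem absVandermonde_concat (k : ℕ) {m M : ℕ} (h : m ≤ M) (y : Fin m → Circle)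
    (x : Fin (M - m) → Circle) :
    (absVandermonde (2 * k) (concat h y x) : ℂ) =
      absVandermonde (2 * k) y * absVandermonde (2 * k) x *
        ∏ i, ∏ n, ((1 - (x i : ℂ) / y n) * (1 - (y n : ℂ) / x i)) ^ k := by
  rw [absVandermonde_two_mul, absVandermonde_two_mul, absVandermonde_two_mul,
    ← dysonProd_const_sum, ← dysonProd_const_comp_equiv k _
      (finSumFinEquiv.trans (finCongr (Nat.add_sub_of_le h)))]
  congr 1
  ext i
  rcases i with i | i <;> simp [concat]

/-- Inverse variables are chosen so that the later integrals carry `z ^ (-δ𝔲)` and extract `b_{δ𝔲}`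
rather than `b_{-δ𝔲}`. Every `x_i` lies in `K - 1` pairs. -/
theorem absVandermonde_eq_prod_inv {k : ℕ} (hk : Even k) {K : ℕ} (x : Fin K → Circle) :
    (absVandermonde (2 * k) x : ℂ) =
      (∏ i, ∏ j ∈ Finset.Ioi i, ((x j : ℂ)⁻¹ - (x i : ℂ)⁻¹) ^ (2 * k)) *
        ∏ i, (x i : ℂ) ^ (k * (K - 1)) := by
  have h : ∀ i j : Fin K, ((‖(x j : ℂ) - x i‖ ^ (2 * k) : ℝ) : ℂ) =
      ((x j : ℂ)⁻¹ - (x i : ℂ)⁻¹) ^ (2 * k) * ((x j : ℂ) ^ k * (x i : ℂ) ^ k) := by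
    intro i j
    have hi := Circle.coe_ne_zero (x i)
    have hj := Circle.coe_ne_zero (x j)
    have h1 : (1 - (x j : ℂ) / x i) * (1 - (x i : ℂ) / x j) =
        (1 - (x j : ℂ)⁻¹ / (x i : ℂ)⁻¹) * (1 - (x i : ℂ)⁻¹ / (x j : ℂ)⁻¹) := by
      field_simp
    rw [pow_mul, Complex.ofReal_pow, normSq_sub_eq, h1,
      one_sub_div_mul_one_sub_div_pow hk (inv_ne_zero hj) (inv_ne_zero hi)]
    simp [mul_assoc]
  simp_rw [absVandermonde, Complex.ofReal_prod, h, Finset.prod_mul_distrib]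
  congr 1
  rw [Finset.prod_comm' (t' := Finset.univ) (s' := fun j => Finset.Iio j)
    (f := fun i j => (x j : ℂ) ^ k) (by simp), ← Finset.prod_mul_distrib]
  refine Finset.prod_congr rfl fun i _ => ?_
  rw [Finset.prod_const, Finset.prod_const, Fin.card_Iio, Fin.card_Ioi, ← pow_mul, ← pow_mul,
    ← pow_add, ← mul_add]
  congr 2
  have := i.2
  omega

/-! ### Integration of products of multivectors -/

theorem integral_multilinearMap_sum_smul {K : ℕ} {U E : Type*} [AddCommGroup E] [Module ℂ E]
    (Φ : MultilinearMap ℂ (fun _ : Fin K => E) ℂ) (S : Finset U) {c : U → Circle → ℂ}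
    (hc : ∀ u ∈ S, Continuous (c u)) (e : U → E) :
    ∫ x : Fin K → Circle, Φ (fun i => ∑ u ∈ S, c u (x i) • e u) ∂haarTorus K =
      Φ fun _ => ∑ u ∈ S, (∫ z, c u z ∂haarCircle) • e u := by
  classical
  simp_rw [MultilinearMap.map_sum_finset, MultilinearMap.map_smul_univ]
  rw [integral_finsetSum]
  · refine Finset.sum_congr rfl fun r _ => ?_
    simp_rw [smul_eq_mul]
    rw [integral_mul_const, haarTorus, integral_fintype_prod_eq_prod fun i => c (r i)]
  · intro r hr
    simp_rw [smul_eq_mul]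
    refine integrable_of_continuous (Continuous.mul (continuous_finsetProd _ fun i _ => ?_)
      continuous_const)
    exact (hc _ (Fintype.mem_piFinset.1 hr i)).comp (continuous_apply i)

theorem sum_coe_fin (L : ℕ) : ∑ l : Fin L, ((l : ℕ) : ℚ) = L * (L - 1) / 2 := by
  rw [Fin.sum_univ_eq_sum_range (fun l => (l : ℚ))]
  induction L with
  | zero => simp
  | succ n ih => rw [Finset.sum_range_succ, ih]; push_cast; ring

/-- The identity behind it is `L(LK - 1)/2 = L(L - 1)/2 + k(K - 1)`; in particular the excess is an
integer. -/
theorem excess_eq {L K k : ℕ} (hk : 2 * k = L ^ 2) (hK : 0 < K) (u : Fin L → Fin (L * K)) :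
    excess u = ((∑ i, ((u i : ℕ) : ℤ) - ∑ l : Fin L, ((l : ℕ) : ℤ) - (k * (K - 1) : ℕ) : ℤ) : ℚ) := by
  have h2 : (2 * k : ℚ) = L ^ 2 := by exact_mod_cast hk
  push_cast [Nat.cast_sub (show 1 ≤ K from hK)]
  rw [excess, sum_coe_fin]
  push_cast
  linear_combination ((K : ℚ) - 1) / 2 * h2

open Classical in
theorem fPowEpsilon_eq_sum {L K k m : ℕ} (hL0 : 0 < L) (hk : 2 * k = L ^ 2)
    (y : Fin m → Circle) :
    fPowEpsilon (L ^ 2) (L * K) L y = ∑ u : Fin L → Fin (L * K) with StrictMono u,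
      ((fPow (L ^ 2) y).coeff (∑ i, ((u i : ℕ) : ℤ) - ∑ l : Fin L, ((l : ℕ) : ℤ) -
        (k * (K - 1) : ℕ)) * normVandermonde u) • basisVector u := by
  have hk2 : L ^ 2 / 2 = k := by omega
  simp only [fPowEpsilon, epsilon, Finset.smul_sum, Finset.sum_filter]
  rw [Finset.sum_comm]
  refine Finset.sum_congr rfl fun u _ => ?_
  by_cases hu : StrictMono u
  · have hK : 0 < K := by
      rcases Nat.eq_zero_or_pos K with rfl | h
      · exact absurd (u ⟨0, hL0⟩).2 (by simp)
      · exact h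
    simp only [hu, true_and, if_true, excess_eq hk hK, Int.cast_inj, smul_ite,
      smul_zero]
    rw [Finset.sum_ite_eq, hk2]
    split_ifs with hmem
    · rw [smul_smul]
    · rw [← hk, coeff_fPow_eq_zero k y hmem]
      simp
  · simp [hu]

theorem integral_absVandermonde_mul_prod {L k : ℕ} (hL0 : 0 < L) (hk : 2 * k = L ^ 2)
    (hke : Even k) {m K : ℕ} (y : Fin m → Circle) :
    ∫ x : Fin K → Circle, (absVandermonde (L ^ 2) x : ℂ) *
        ∏ i, ∏ n, ((1 - (x i : ℂ) / y n) * (1 - (y n : ℂ) / x i)) ^ k ∂haarTorus K =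
      (∏ n, (y n : ℂ) ^ (-((k * K : ℕ) : ℤ))) *
        volumeCoeff (L * K) (fPowEpsilon (L ^ 2) (L * K) L y ^ K) := by
  classical
  let Φ : MultilinearMap ℂ (fun _ : Fin K => Ext (L * K)) ℂ :=
    (volumeCoeff (L * K)).compMultilinearMap (MultilinearMap.mkPiAlgebraFin ℂ K (Ext (L * K)))
  let S : Finset (Fin L → Fin (L * K)) := Finset.univ.filter fun u => StrictMono u
  let d : (Fin L → Fin (L * K)) → ℤ := fun u =>
    ∑ i, ((u i : ℕ) : ℤ) - ∑ l : Fin L, ((l : ℕ) : ℤ) - (k * (K - 1) : ℕ)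
  let c : (Fin L → Fin (L * K)) → Circle → ℂ := fun u z =>
    ((z : ℂ) ^ (-d u) * laurentEval z (fPow (L ^ 2) y)) * normVandermonde u
  have hk2 : L ^ 2 / 2 = k := by omega
  have hfactor : ∀ z : Circle, ∏ n, ((1 - (z : ℂ) / y n) * (1 - (y n : ℂ) / z)) ^ k =
      (∏ n, ((y n : ℂ) ^ k)⁻¹) * laurentEval z (fPow (L ^ 2) y) := by
    intro z
    simp_rw [one_sub_div_mul_one_sub_div_pow hke (Circle.coe_ne_zero z) (Circle.coe_ne_zero _)]
    rw [laurentEval_fPow, Finset.prod_mul_distrib, Finset.prod_mul_distrib, Finset.prod_const,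
      Finset.card_univ, Fintype.card_fin, hk, hk2, zpow_neg, zpow_natCast, pow_mul, inv_pow]
    ring
  -- All scalar factors in one variable are absorbed into its block; the exponent of `z` in the
  -- coefficient of `e_𝔲` then becomes exactly minus the excess.
  have hblock : ∀ z : Circle, (((z : ℂ) ^ (k * (K - 1))) * laurentEval z (fPow (L ^ 2) y)) •
      confluentWedge (L * K) L (z : ℂ)⁻¹ = ∑ u ∈ S, c u z • basisVector u := by
    intro z
    have hz := Circle.coe_ne_zero z
    rw [confluentWedge_eq_sum _ _ (inv_ne_zero hz), Finset.smul_sum]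
    refine Finset.sum_congr rfl fun u _ => ?_
    rw [smul_smul]
    congr 1
    have hd : -d u = (k * (K - 1) : ℕ) +
        -(∑ i, ((u i : ℕ) : ℤ) - ∑ l : Fin L, ((l : ℕ) : ℤ)) := by
      simp only [d]
      ring
    simp only [c]
    rw [hd, zpow_add₀ hz, zpow_natCast, inv_zpow, zpow_neg]
    ring
  have hint : ∀ x : Fin K → Circle, (absVandermonde (L ^ 2) x : ℂ) *
      ∏ i, ∏ n, ((1 - (x i : ℂ) / y n) * (1 - (y n : ℂ) / x i)) ^ k =
      (∏ n, (y n : ℂ) ^ (-((k * K : ℕ) : ℤ))) *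
        Φ fun i => ∑ u ∈ S, c u (x i) • basisVector u := by
    intro x
    simp_rw [← hblock, MultilinearMap.map_smul_univ]
    have hΦ : (Φ fun i => confluentWedge (L * K) L (x i : ℂ)⁻¹) =
        ∏ i, ∏ j ∈ Finset.Ioi i, ((x j : ℂ)⁻¹ - (x i : ℂ)⁻¹) ^ (L ^ 2) :=
      volumeCoeff_prod_confluentWedge fun i => (x i : ℂ)⁻¹
    have hy : ∏ _i : Fin K, ∏ n, ((y n : ℂ) ^ k)⁻¹ =
        ∏ n, (y n : ℂ) ^ (-((k * K : ℕ) : ℤ)) := by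
      rw [Finset.prod_const, Finset.card_univ, Fintype.card_fin, ← Finset.prod_pow]
      refine Finset.prod_congr rfl fun n _ => ?_
      rw [zpow_neg, zpow_natCast, inv_pow, pow_mul]
    rw [hΦ, ← hk, absVandermonde_eq_prod_inv hke]
    simp_rw [hfactor, Finset.prod_mul_distrib, hy, hk, smul_eq_mul]
    ring
  simp_rw [hint]
  rw [integral_const_mul, integral_multilinearMap_sum_smul Φ S]
  · congr 1
    have hsum : ∑ u ∈ S, (∫ z, c u z ∂haarCircle) • basisVector u =
        fPowEpsilon (L ^ 2) (L * K) L y := by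
      rw [fPowEpsilon_eq_sum hL0 hk]
      refine Finset.sum_congr rfl fun u _ => ?_
      simp only [c]
      rw [integral_mul_const, integral_zpow_mul_laurentEval]
    rw [hsum]
    simp only [Φ, LinearMap.compMultilinearMap_apply, MultilinearMap.mkPiAlgebraFin_apply_const]
  · intro u _
    exact ((continuous_coe_zpow _).mul (continuous_laurentEval _)).mul continuous_const

theorem correlation_eq_hyperpfaffian {L k M m : ℕ} (hL0 : 0 < L) (hk : 2 * k = L ^ 2)
    (hke : Even k) (hmM : m ≤ M) (y : Fin m → Circle) :
    (correlation (L ^ 2) hmM y : ℂ) =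
      (M.factorial : ℂ) * ((Nat.multinomial Finset.univ fun _ : Fin M => k : ℕ) : ℂ)⁻¹ *
        (absVandermonde (L ^ 2) y : ℂ) * (∏ n, (y n : ℂ) ^ (-((k * (M - m) : ℕ) : ℤ))) *
        hyperpfaffian L (M - m) (fPowEpsilon (L ^ 2) (L * (M - m)) L y) := by
  -- Dyson's identity normalizes the density. Of the prefactor `M! / (M - m)!`, the denominator goes
  -- into the hyperpfaffian.
  have hZ : (M.factorial : ℝ) * partitionFunction (L ^ 2) M =
      Nat.multinomial Finset.univ fun _ : Fin M => k := by
    rw [partitionFunction, ← hk, integral_absVandermonde, ← mul_assoc,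
      mul_one_div_cancel (by exact_mod_cast Nat.factorial_ne_zero M), one_mul]
  simp_rw [correlation, jointDensity, hZ]
  rw [integral_const_mul, Complex.ofReal_mul, Complex.ofReal_mul, ← integral_complex_ofReal]
  have hc : ∀ x : Fin (M - m) → Circle, (absVandermonde (L ^ 2) (concat hmM y x) : ℂ) =
      absVandermonde (L ^ 2) y * ((absVandermonde (L ^ 2) x : ℂ) *
        ∏ i, ∏ n, ((1 - (x i : ℂ) / y n) * (1 - (y n : ℂ) / x i)) ^ k) := by
    intro x
    rw [← hk, absVandermonde_concat, mul_assoc]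
  simp_rw [hc]
  rw [integral_const_mul, integral_absVandermonde_mul_prod hL0 hk hke, hyperpfaffian, map_smul,
    smul_eq_mul]
  push_cast
  ring

end CircularEnsemble

end

theorem mainTheorem3 (L M m : ℕ) (hL : Even L) (hL0 : 0 < L) (hm : 1 ≤ m) (hmM : m ≤ M) :
    CircularEnsemble.IsCorrelationFunction (CircularEnsemble.law (L ^ 2) M) m
        (CircularEnsemble.correlation (L ^ 2) hmM) ∧
      ∀ y : Fin m → Circle,
        (CircularEnsemble.correlation (L ^ 2) hmM y : ℂ) =
          (M.factorial : ℂ) *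
            ((Nat.multinomial Finset.univ fun _ : Fin M => L ^ 2 / 2 : ℕ) : ℂ)⁻¹ *
            (CircularEnsemble.absVandermonde (L ^ 2) y : ℂ) *
            (∏ n, (y n : ℂ) ^ (-((L ^ 2 / 2 * (M - m) : ℕ) : ℤ))) *
            CircularEnsemble.hyperpfaffian L (M - m)
              (CircularEnsemble.fPowEpsilon (L ^ 2) (L * (M - m)) L y) := by
  obtain ⟨a, rfl⟩ := hL
  -- With `L = 2a`, half of `β` is `2a²`, which is even as the sign cancellation requires.
  have hk : 2 * (2 * a ^ 2) = (a + a) ^ 2 := by ring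
  have hk2 : (a + a) ^ 2 / 2 = 2 * a ^ 2 := by omega
  refine ⟨?_, fun y => ?_⟩
  · rw [← hk]
    exact CircularEnsemble.isCorrelationFunction_correlation _ hmM
  · rw [hk2]
    exact CircularEnsemble.correlation_eq_hyperpfaffian hL0 hk (even_two_mul _) hmM y
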